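/- Let $P$ be a finite nonempty set of points in the half-open unit square $[0,1)^2$ and let $S_0=P+\mathbb Z^2$ be the corresponding periodic point set. Let $s$ be the length of the shortest edge in the Delaunay triangulation of $S_0$ (a Delaunay edge is a pair of distinct points on a common circle, and a Delaunay triangle a non-degenerate triangle on a circle, whose interior contains no point of the set). A triangle is poorly shaped if the ratio of its circumradius to its shortest edge is larger than $\beta_R=\sqrt2$; it is in class $\mathcal E_i$ ($i\ge 1$) if its shortest edge has length in $[\sqrt2^{\,i-1}s,\sqrt2^{\,i}s)$. Two circles are conflicting if each contains the other's center in its interior, and independent otherwise. Parallel Ruppert's Refinement with size parameter $L$ starts with the vertex set $S=S_0$. Its outer loop runs over $i=1,\dots,N$, where $N=\lceil\log_{\sqrt2}(L/s)\rceil$ (and $N=0$ if this is not positive). In pass $i$, its inner loop does the following as long as some Delaunay triangle of $S$ in class $\mathcal E_i$ is poorly shaped: choose any $\mathbb Z^2$-periodic maximal independent subset of the set of circumcircles of all poorly shaped Delaunay triangles of $S$ in class $\mathcal E_i$, and insert all the centers of the chosen circles into $S$. **Theorem.** For every $c>0$ there is a constant $C$, depending only on $c$, such that the following holds for all $P$ as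 above and all $L$ with $L\ge c$ and $L\ge\operatorname{diam}(P)$ (for instance $L=\operatorname{diam}(P)$ if $\operatorname{diam}(P)\ge c$; or, with $c=\sqrt2$, always $L=\sqrt2$, the diameter of the unit square). One has $s>0$. The number $N$ of passes of the outer loop is at most $C\max(1,\log(L/s))$. In every run of the algorithm, whatever maximal independent sets are chosen, each inner loop executes at most $C\max(1,\log(L/s))$ iterations, and the total number of iterations of all inner loops is at most $C\max(1,\log(L/s))^2$; moreover a run never gets stuck before the $N$ passes are completed (a periodic maximal independent set exists whenever there is a candidate), so every run terminates within these bounds. That is, the algorithm takes $O(\log^2(L/s))$ iterations. -/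

import Mathlib

/-- The Euclidean plane. -/
abbrev Plane : Type := EuclideanSpace ℝ (Fin 2)

namespace Refinement

/-- The integer vector `v`, as a vector of the plane. -/
noncomputable def latticeVec (v : Fin 2 → ℤ) : Plane := WithLp.toLp 2 (fun k => (v k : ℝ))

/-- The periodic point set `P + ℤ²`. -/
def periodicSet (P : Set Plane) : Set Plane :=
  {x | ∃ p ∈ P, ∃ v : Fin 2 → ℤ, x = p + latticeVec v}

/-- `{p, q}` is a Delaunay edge of `S`: two distinct points of `S` that lie on a common circle
with no point of `S` in its interior. -/
def IsDelaunayEdge (S : Set Plane) (p q : Plane) : Prop :=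
  p ∈ S ∧ q ∈ S ∧ p ≠ q ∧
    ∃ c : Plane, dist p c = dist q c ∧ ∀ x ∈ S, dist p c ≤ dist x c

/-- The length of the shortest edge in the Delaunay triangulation of `S`. -/
noncomputable def shortestDelaunayEdge (S : Set Plane) : ℝ :=
  sInf {d : ℝ | ∃ p q : Plane, IsDelaunayEdge S p q ∧ d = dist p q}

/-- `T` is a Delaunay triangle of `S`: its vertices are in `S`, and no point of `S` is in the
interior of its circumcircle. -/
def IsDelaunayTriangle (S : Set Plane) (T : Affine.Triangle ℝ Plane) : Prop :=
  (∀ k, T.points k ∈ S) ∧ ∀ x ∈ S, T.circumradius ≤ dist x T.circumcenter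

/-- The length of the shortest edge of a triangle. -/
noncomputable def shortestSide (T : Affine.Triangle ℝ Plane) : ℝ :=
  min (dist (T.points 0) (T.points 1))
    (min (dist (T.points 1) (T.points 2)) (dist (T.points 2) (T.points 0)))

/-- A triangle is poorly shaped, for the threshold `β`, if the ratio of its circumradius to its
shortest edge is larger than `β`. -/
def PoorlyShaped (β : ℝ) (T : Affine.Triangle ℝ Plane) : Prop :=
  β < T.circumradius / shortestSide T

/-- The triangle `T` is in the edge-length class number `i`, counted from `0`: its shortest edge
has length in `[(√2) ^ i * s, (√2) ^ (i + 1) * s)`. -/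
def InClass (s : ℝ) (i : ℕ) (T : Affine.Triangle ℝ Plane) : Prop :=
  shortestSide T ∈ Set.Ico ((√2 : ℝ) ^ i * s) ((√2 : ℝ) ^ (i + 1) * s)

/-- The candidate circles of class `i` for the current vertex set `S`: the circumcircles of the
poorly shaped Delaunay triangles in class `i`, for the threshold `√2`. -/
def candidates (s : ℝ) (i : ℕ) (S : Set Plane) : Set (EuclideanGeometry.Sphere Plane) :=
  {c | ∃ T : Affine.Triangle ℝ Plane,
    IsDelaunayTriangle S T ∧ PoorlyShaped √2 T ∧ InClass s i T ∧ c = T.circumsphere}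

/-- Two circles are conflicting if each contains the other's center in its interior. -/
def Conflicting (a b : EuclideanGeometry.Sphere Plane) : Prop :=
  b.center ∈ Metric.ball a.center a.radius ∧ a.center ∈ Metric.ball b.center b.radius

/-- A set of circles is independent if no two different members are conflicting. -/
def IsIndependent (I : Set (EuclideanGeometry.Sphere Plane)) : Prop :=
  I.Pairwise (fun a b => ¬ Conflicting a b)

/-- `I` is a maximal independent subset of `C`. -/
def IsMaximalIndependent (C I : Set (EuclideanGeometry.Sphere Plane)) : Prop :=
  Maximal (fun J => J ⊆ C ∧ IsIndependent J) I

/-- A set of circles is invariant under translation by integer vectors. -/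
def IsPeriodic (I : Set (EuclideanGeometry.Sphere Plane)) : Prop :=
  ∀ c ∈ I, ∀ v : Fin 2 → ℤ,
    (⟨c.center + latticeVec v, c.radius⟩ : EuclideanGeometry.Sphere Plane) ∈ I

/-- The configuration of a run of the algorithm: the number `phase` of completed passes of the
outer loop (so `phase` is also the class that is being treated), the number `inner` of iterations
of the current inner loop so far, the number `total` of inner iterations in the whole run so far,
and the current vertex set `mesh` of the triangulation. -/
structure Config where
  phase : ℕ
  inner : ℕ
  total : ℕ
  mesh : Set Plane

/-- The initial configuration on the periodic point set `S`. -/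
def Config.init (S : Set Plane) : Config := ⟨0, 0, 0, S⟩

/-- One step of Parallel Ruppert's Refinement, with `N` passes of the outer loop. -/
inductive Step (s : ℝ) (N : ℕ) : Config → Config → Prop
  /-- An iteration of the inner loop: while there are candidates in the current class, choose a
  (periodic) maximal independent set of them and insert all its centers. -/
  | insert {i k n : ℕ} {S : Set Plane} (I : Set (EuclideanGeometry.Sphere Plane))
      (hi : i < N) (hne : (candidates s i S).Nonempty)
      (hmax : IsMaximalIndependent (candidates s i S) I) (hper : IsPeriodic I) :
      Step s N ⟨i, k, n, S⟩
        ⟨i, k + 1, n + 1, S ∪ EuclideanGeometry.Sphere.center '' I⟩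
  /-- The inner loop ends when the current class has no candidates; go to the next class. -/
  | next {i k n : ℕ} {S : Set Plane} (hi : i < N) (hempty : candidates s i S = ∅) :
      Step s N ⟨i, k, n, S⟩ ⟨i + 1, 0, n, S⟩

/-- The number of passes of the outer loop, `⌈log_{√2} (L / s)⌉`. -/
noncomputable def outerPasses (L s : ℝ) : ℕ := ⌈Real.logb √2 (L / s)⌉₊

/-- `X` occurs in some run of Parallel Ruppert's Refinement on the periodic point set `P + ℤ²`,
with the size parameter `L`. -/
def Reachable (P : Set Plane) (L : ℝ) (X : Config) : Prop :=
  Relation.ReflTransGen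
    (Step (shortestDelaunayEdge (periodicSet P))
      (outerPasses L (shortestDelaunayEdge (periodicSet P))))
    (Config.init (periodicSet P)) X

end Refinement

namespace Refinement

open Metric
open EuclideanGeometry (Sphere)
open scoped RealInnerProductSpace

/-! Suppose that the inner loop for class `i` has run `K` iterations and a poorly shaped triangle is
left, with shortest edge `pq`. A candidate circle has radius above the upper end of the class, so an
inserted center is farther than that from every other vertex (`Inserts.mem_of_dist_le`). Hence `p`
and `q` are present from the start of the loop.

Look at the empty circles through `p` and `q` whose centers lie on the bisector, on the side of the
surviving triangle. At each time `j` the largest one is the circumcircle of a Delaunay triangle with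
a side `pq` and at least the surviving circumradius (`exists_maximal_empty_circle`). It is poorly
shaped, and of class `i` because smaller classes stay free of poor triangles (`GoodMesh.inserts`).
So it is a candidate, and by maximality a new vertex falls into it (`Inserts.exists_mem_ball`).

The radii `R j` therefore decrease. A new vertex near the center costs a constant factor at once
(`radius_le_of_near_center`). New vertices that all stay near the boundary are far apart, because
each is at least as far from older vertices as from its circle's center; packing allows at most 25
of them (`not_separated_of_dist_le`). So 26 iterations shrink `R` by the factor 47/50
(`exists_decreasing_radii`). As `R` stays between `s` and 1, `K = O(1 + log (1/s))`. There are
`O(max 1 (log (L/s)))` passes, and `c ≤ L` turns `log (1/s)` into `log (L/s)`. -/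

/-! ### Lattice vectors and separated sets -/

lemma latticeVec_add (v w : Fin 2 → ℤ) : latticeVec (v + w) = latticeVec v + latticeVec w := by
  ext k; simp [latticeVec]

lemma latticeVec_neg (v : Fin 2 → ℤ) : latticeVec (-v) = -latticeVec v := by
  ext k; simp [latticeVec]

lemma latticeVec_zero : latticeVec 0 = 0 := by
  ext k; simp [latticeVec]

/-- A nonzero lattice vector has length at least one. -/
lemma one_le_norm_latticeVec {v : Fin 2 → ℤ} (hv : v ≠ 0) : 1 ≤ ‖latticeVec v‖ := by
  obtain ⟨k, hk⟩ := Function.ne_iff.1 hv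
  have h1 : ‖latticeVec v k‖ ≤ ‖latticeVec v‖ := PiLp.norm_apply_le _ _
  have h2 : (1 : ℝ) ≤ ‖latticeVec v k‖ := by
    have : 1 ≤ |v k| := Int.one_le_abs hk
    have h3 : ((1 : ℤ) : ℝ) ≤ ((|v k| : ℤ) : ℝ) := by exact_mod_cast this
    simpa [latticeVec] using h3
  exact h2.trans h1

/-- Every vector is at distance less than one from a lattice vector. -/
lemma exists_dist_latticeVec_lt (x : Plane) : ∃ v, dist (latticeVec v) x < 1 := by
  refine ⟨fun k => round (x k), ?_⟩
  rw [EuclideanSpace.dist_eq, Real.sqrt_lt' one_pos, Fin.sum_univ_two]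
  have h : ∀ k : Fin 2, dist (latticeVec (fun k => round (x k)) k) (x k) ^ 2 ≤ 1 / 4 := by
    intro k
    have := abs_sub_round (x k)
    rw [Real.dist_eq, abs_sub_comm]
    have h0 := abs_nonneg (x k - round (x k))
    simp only [latticeVec]
    nlinarith
  have := h 0
  have := h 1
  norm_num at *
  linarith

/-- Only finitely many lattice vectors lie in a given ball. -/
lemma finite_latticeVec_closedBall (x : Plane) (r : ℝ) :
    {v | latticeVec v ∈ closedBall x r}.Finite := by
  set B : ℝ := r + ‖x‖
  refine (Set.finite_Icc (fun _ : Fin 2 => -⌈B⌉) (fun _ => ⌈B⌉)).subset ?_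
  intro v hv
  have h1 : ‖latticeVec v‖ ≤ B := by
    have h2 : ‖latticeVec v - x‖ ≤ r := by simpa [dist_eq_norm] using hv
    have := norm_le_norm_sub_add (latticeVec v) x
    simp only [B]; linarith
  have h3 : ∀ k, |v k| ≤ ⌈B⌉ := by
    intro k
    have h4 : ‖latticeVec v k‖ ≤ ‖latticeVec v‖ := PiLp.norm_apply_le _ _
    have h5 : ((|v k| : ℤ) : ℝ) ≤ B := by
      have : ‖latticeVec v k‖ = ((|v k| : ℤ) : ℝ) := by simp [latticeVec]
      linarith
    exact_mod_cast h5.trans (Int.le_ceil B)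
  exact ⟨fun k => (abs_le.1 (h3 k)).1, fun k => (abs_le.1 (h3 k)).2⟩

/-- A set with positive minimal distance has finitely many points in every ball. -/
lemma finite_inter_closedBall {S : Set Plane} {s : ℝ} (hs : 0 < s)
    (hsep : ∀ x ∈ S, ∀ y ∈ S, x ≠ y → s ≤ dist x y) (x : Plane) (r : ℝ) :
    (S ∩ closedBall x r).Finite := by
  obtain ⟨t, -, ht, hcov⟩ := (isCompact_closedBall x r).finite_cover_balls (half_pos hs)
  refine (ht.biUnion (t := fun y => S ∩ ball y (s / 2)) ?_).subset ?_
  · intro y _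
    refine Set.Subsingleton.finite ?_
    intro a ha b hb
    by_contra hab
    have h1 := hsep a ha.1 b hb.1 hab
    have h2 := dist_triangle_right a b y
    have h3 := mem_ball.1 ha.2
    have h4 := mem_ball.1 hb.2
    linarith
  · rintro a ⟨haS, ha⟩
    obtain ⟨y, hy, hay⟩ := Set.mem_iUnion₂.1 (hcov ha)
    exact Set.mem_iUnion₂.2 ⟨y, hy, haS, hay⟩

/-! ### Triangles, their shortest sides and translates -/

section Triangle

variable (T : Affine.Triangle ℝ Plane)

lemma shortestSide_le {k l : Fin 3} (h : k ≠ l) :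
    shortestSide T ≤ dist (T.points k) (T.points l) := by
  have h1 : shortestSide T ≤ dist (T.points 0) (T.points 1) := min_le_left _ _
  have h2 : shortestSide T ≤ dist (T.points 1) (T.points 2) :=
    (min_le_right _ _).trans (min_le_left _ _)
  have h3 : shortestSide T ≤ dist (T.points 2) (T.points 0) :=
    (min_le_right _ _).trans (min_le_right _ _)
  fin_cases k <;> fin_cases l <;> first
    | exact absurd rfl h
    | exact h1
    | exact h2
    | exact h3
    | exact h1.trans_eq (dist_comm _ _)
    | exact h2.trans_eq (dist_comm _ _)
    | exact h3.trans_eq (dist_comm _ _)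

lemma exists_shortestSide_eq :
    ∃ k l : Fin 3, k ≠ l ∧ dist (T.points k) (T.points l) = shortestSide T := by
  unfold shortestSide
  rcases min_choice (dist (T.points 0) (T.points 1))
    (min (dist (T.points 1) (T.points 2)) (dist (T.points 2) (T.points 0))) with h | h
  · exact ⟨0, 1, by decide, h.symm⟩
  · rw [h]
    rcases min_choice (dist (T.points 1) (T.points 2)) (dist (T.points 2) (T.points 0)) with h | h
    · exact ⟨1, 2, by decide, h.symm⟩
    · exact ⟨2, 0, by decide, h.symm⟩

lemma shortestSide_pos : 0 < shortestSide T := by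
  obtain ⟨k, l, hkl, h⟩ := exists_shortestSide_eq T
  rw [← h]
  exact dist_pos.2 (fun h => hkl (T.independent.injective h))

lemma poorlyShaped_iff (β : ℝ) : PoorlyShaped β T ↔ β * shortestSide T < T.circumradius := by
  unfold PoorlyShaped
  rw [lt_div_iff₀ (shortestSide_pos T)]

/-- The triangle `T` translated by `v`. -/
noncomputable def translate (v : Plane) : Affine.Triangle ℝ Plane :=
  T.map (AffineIsometryEquiv.constVAdd ℝ Plane v).toAffineIsometry.toAffineMap
    (AffineIsometry.injective _)

lemma translate_points (v : Plane) (k : Fin 3) : (translate T v).points k = T.points k + v := by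
  simp [translate, add_comm]

lemma translate_circumcenter (v : Plane) :
    (translate T v).circumcenter = T.circumcenter + v := by
  simp [translate, add_comm]

lemma translate_circumradius (v : Plane) : (translate T v).circumradius = T.circumradius := by
  simp [translate]

lemma translate_shortestSide (v : Plane) : shortestSide (translate T v) = shortestSide T := by
  simp [shortestSide, translate_points]

end Triangle

/-! ### Empty circles through two fixed points -/

/-- The excess of the squared distance of `x` over that of `p`, from a point of the line through
`m` in a direction `n` that is orthogonal to `p - m`. -/
lemma dist_sq_sub_dist_sq {p m n : Plane} (hpm : ⟪p - m, n⟫ = 0) (x : Plane) (t : ℝ) :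
    dist x (m + t • n) ^ 2 - dist p (m + t • n) ^ 2 =
      ‖x - m‖ ^ 2 - ‖p - m‖ ^ 2 - 2 * t * ⟪x - m, n⟫ := by
  have key : ∀ y : Plane, dist y (m + t • n) ^ 2 =
      ‖y - m‖ ^ 2 - 2 * t * ⟪y - m, n⟫ + ‖t • n‖ ^ 2 := by
    intro y
    rw [dist_eq_norm, ← sub_sub, norm_sub_sq_real, inner_smul_right]
    ring
  rw [key, key, hpm]
  ring

/-- The quadratic terms in `t` cancel, so emptiness of the circle is a system of linear inequalities
in `t`, one for each vertex. -/
lemma dist_le_dist_iff {p m n : Plane} (hpm : ⟪p - m, n⟫ = 0) (x : Plane) (t : ℝ) :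
    dist p (m + t • n) ≤ dist x (m + t • n) ↔
      2 * t * ⟪x - m, n⟫ ≤ ‖x - m‖ ^ 2 - ‖p - m‖ ^ 2 := by
  rw [← sq_le_sq₀ dist_nonneg dist_nonneg, ← sub_nonneg, dist_sq_sub_dist_sq hpm, sub_nonneg]

/-- A circle through `p` and `q` with no point of `S` in its interior can be enlarged, with `p` and
`q` kept on it and its center moved in the direction `n`, to the circumcircle of a Delaunay
triangle, and this is the largest empty circle of its kind. -/
lemma exists_maximal_empty_circle {S : Set Plane}
    (hfin : ∀ (x : Plane) (r : ℝ), (S ∩ closedBall x r).Finite)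
    (hcov : ∀ x, ∃ y ∈ S, dist y x < 1) {p q m n : Plane} (hp : p ∈ S) (hq : q ∈ S) (hpq : p ≠ q)
    (hn : ‖n‖ = 1) (hpm : ⟪p - m, n⟫ = 0) (hqm : ⟪q - m, n⟫ = 0) (heq : ‖p - m‖ = ‖q - m‖)
    {t₀ : ℝ} (h₀ : ∀ x ∈ S, dist p (m + t₀ • n) ≤ dist x (m + t₀ • n)) :
    ∃ t, t₀ ≤ t ∧ (∀ t', (∀ x ∈ S, dist p (m + t' • n) ≤ dist x (m + t' • n)) → t' ≤ t) ∧
      (∀ x ∈ S, dist p (m + t • n) ≤ dist x (m + t • n)) ∧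
      ∃ T : Affine.Triangle ℝ Plane, IsDelaunayTriangle S T ∧ shortestSide T ≤ dist p q ∧
        T.circumcenter = m + t • n ∧ T.circumradius = dist p (m + t • n) := by
  simp only [dist_le_dist_iff hpm] at h₀
  set a : Plane → ℝ := fun x => ⟪x - m, n⟫ with ha
  set g : Plane → ℝ := fun x => ‖x - m‖ ^ 2 - ‖p - m‖ ^ 2 with hg
  have ha' : ∀ x, ⟪x - m, n⟫ = a x := fun _ => rfl
  have hg' : ∀ x, ‖x - m‖ ^ 2 - ‖p - m‖ ^ 2 = g x := fun _ => rfl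
  simp only [ha', hg'] at h₀
  obtain ⟨x₁, hx₁, hd₁⟩ := hcov (m + n)
  -- A vertex at distance less than 1 from `m + n` lies strictly on the `n` side of the line, so `t`
  -- is bounded above.
  have hax₁ : 0 < a x₁ := by
    have h1 : ⟪x₁ - (m + n), n⟫ = a x₁ - 1 := by
      rw [← sub_sub, inner_sub_left, real_inner_self_eq_norm_sq, hn]; simp [ha]
    have h2 := abs_real_inner_le_norm (x₁ - (m + n)) n
    rw [h1, hn, mul_one, ← dist_eq_norm] at h2
    have := (abs_le.1 h2).1
    linarith
  -- `τ` is the parameter at which the growing circle reaches `x₁`. The vertices reached no later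
  -- all lie in the disk for `τ`, so a first one, `y`, exists.
  set τ := g x₁ / (2 * a x₁) with hτ
  set A := {x ∈ S | 0 < a x ∧ g x / (2 * a x) ≤ τ} with hA
  have hAfin : A.Finite := by
    refine (hfin (m + τ • n) (dist p (m + τ • n))).subset ?_
    rintro x ⟨hxS, hax, hx⟩
    refine ⟨hxS, ?_⟩
    rw [div_le_iff₀ (by positivity)] at hx
    rw [mem_closedBall, ← sq_le_sq₀ dist_nonneg dist_nonneg]
    have := dist_sq_sub_dist_sq hpm x τ
    rw [hg', ha'] at this
    linarith
  obtain ⟨y, hyA, hymin⟩ := Set.exists_min_image A (fun x => g x / (2 * a x)) hAfin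
    ⟨x₁, hx₁, hax₁, le_rfl⟩
  obtain ⟨hyS, hay, hyτ⟩ := hyA
  set t := g y / (2 * a y) with ht
  have hty : 2 * t * a y = g y := by rw [ht]; field_simp
  have hmin : ∀ x ∈ S, 0 < a x → t ≤ g x / (2 * a x) := by
    intro x hx hax
    by_cases h : g x / (2 * a x) ≤ τ
    · exact hymin x ⟨hx, hax, h⟩
    · exact hyτ.trans (not_le.1 h).le
  have ht₀ : t₀ ≤ t := by
    rw [ht, le_div_iff₀ (by positivity)]
    linarith [h₀ y hyS]
  have hempty : ∀ x ∈ S, 2 * t * a x ≤ g x := by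
    intro x hx
    rcases le_or_gt (a x) 0 with hax | hax
    -- For `a x ≤ 0` the constraint only weakens as `t` grows from `t₀`.
    · nlinarith [h₀ x hx]
    · have := hmin x hx hax
      rw [le_div_iff₀ (by positivity)] at this
      linarith
  refine ⟨t, ht₀, ?_, ?_, ?_⟩
  · intro t' ht'
    have := (dist_le_dist_iff hpm y t').1 (ht' y hyS)
    rw [ha', hg'] at this
    rw [ht, le_div_iff₀ (by positivity)]
    linarith
  · intro x hx
    exact (dist_le_dist_iff hpm x t).2 (hempty x hx)
  -- The function `a` vanishes at `p` and `q` but is positive at `y`.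
  have hind : AffineIndependent ℝ ![p, q, y] := by
    rw [affineIndependent_iff_not_collinear_set]
    intro hcol
    obtain ⟨v, hv⟩ := (collinear_iff_of_mem (p₀ := p) (by simp)).1 hcol
    obtain ⟨r, hr⟩ := hv q (by simp)
    obtain ⟨r', hr'⟩ := hv y (by simp)
    have h1 : r * ⟪v, n⟫ = 0 := by
      rw [← real_inner_smul_left, show r • v = (q - m) - (p - m) by rw [hr, vadd_eq_add]; abel,
        inner_sub_left, hpm, hqm, sub_zero]
    have h2 : r' * ⟪v, n⟫ = a y := by
      rw [← real_inner_smul_left, show r' • v = (y - m) - (p - m) by rw [hr', vadd_eq_add]; abel,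
        inner_sub_left, hpm, sub_zero]
    have hr0 : r ≠ 0 := by
      rintro rfl
      apply hpq
      simpa using hr.symm
    have h3 : ⟪v, n⟫ = 0 := by simpa [hr0] using h1
    rw [h3, mul_zero] at h2
    exact hay.ne h2
  set T : Affine.Triangle ℝ Plane := ⟨![p, q, y], hind⟩ with hT
  have hspan : affineSpan ℝ (Set.range T.points) = ⊤ := by
    rw [T.independent.affineSpan_eq_top_iff_card_eq_finrank_add_one]
    simp
  have hdist : ∀ k, dist (T.points k) (m + t • n) = dist p (m + t • n) := by
    have aux : ∀ x, 2 * t * a x = g x → dist x (m + t • n) = dist p (m + t • n) := by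
      intro x hx
      rw [← sq_eq_sq₀ dist_nonneg dist_nonneg, ← sub_eq_zero, dist_sq_sub_dist_sq hpm, ha', hg', hx,
        sub_self]
    intro k
    fin_cases k
    · rfl
    · refine aux q ?_
      simp only [ha, hg, hqm, heq]; ring
    · exact aux y hty
  have hc := T.eq_circumcenter_of_dist_eq (p := m + t • n) (by rw [hspan]; trivial) hdist
  have hr := T.eq_circumradius_of_dist_eq (p := m + t • n) (by rw [hspan]; trivial) hdist
  refine ⟨T, ⟨?_, ?_⟩, ?_, hc.symm, hr.symm⟩
  · intro k
    fin_cases k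
    exacts [hp, hq, hyS]
  · intro x hx
    rw [← hc, ← hr]
    exact (dist_le_dist_iff hpm x t).2 (hempty x hx)
  · exact shortestSide_le T (k := 0) (l := 1) (by decide)

lemma dist_add_smul_sq {p m n : Plane} (hn : ‖n‖ = 1) (hpm : ⟪p - m, n⟫ = 0) (t : ℝ) :
    dist p (m + t • n) ^ 2 = t ^ 2 + ‖p - m‖ ^ 2 := by
  rw [dist_eq_norm, ← sub_sub, norm_sub_sq_real, inner_smul_right, hpm, norm_smul, hn, mul_one,
    Real.norm_eq_abs, sq_abs]
  ring

/-- A point that is equidistant from `p` and `q`, in polar form from the midpoint. -/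
lemma exists_bisector_direction {p q c : Plane} (hc : dist p c = dist q c)
    (hlt : dist p q < dist p c) :
    ∃ (m n : Plane) (t : ℝ), 0 ≤ t ∧ c = m + t • n ∧ ‖n‖ = 1 ∧ ⟪p - m, n⟫ = 0 ∧ ⟪q - m, n⟫ = 0 ∧
      ‖p - m‖ = dist p q / 2 ∧ ‖q - m‖ = dist p q / 2 := by
  set m := midpoint ℝ p q with hm
  have h1 : ‖p - m‖ = dist p q / 2 := by
    rw [← dist_eq_norm, dist_left_midpoint]; norm_num; ring
  have h2 : ‖q - m‖ = dist p q / 2 := by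
    rw [← dist_eq_norm, dist_right_midpoint]; norm_num; ring
  have hqm : q - m = -(p - m) := by
    rw [hm, left_sub_midpoint, right_sub_midpoint, ← smul_neg, neg_sub]
  have hcm : c - m ≠ 0 := by
    intro h
    rw [sub_eq_zero] at h
    rw [h, dist_eq_norm p m, h1] at hlt
    linarith [dist_nonneg (x := p) (y := q)]
  have hcm' : ‖c - m‖ ≠ 0 := norm_ne_zero_iff.2 hcm
  have horth : ⟪p - m, c - m⟫ = 0 := by
    have e1 : dist p c ^ 2 = ‖p - m‖ ^ 2 - 2 * ⟪p - m, c - m⟫ + ‖c - m‖ ^ 2 := by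
      rw [← norm_sub_sq_real, dist_eq_norm, sub_sub_sub_cancel_right]
    have e2 : dist q c ^ 2 = ‖q - m‖ ^ 2 - 2 * ⟪q - m, c - m⟫ + ‖c - m‖ ^ 2 := by
      rw [← norm_sub_sq_real, dist_eq_norm, sub_sub_sub_cancel_right]
    rw [hqm, norm_neg, inner_neg_left] at e2
    rw [hc] at e1
    linarith
  have hp0 : ⟪p - m, (‖c - m‖⁻¹ : ℝ) • (c - m)⟫ = 0 := by rw [inner_smul_right, horth, mul_zero]
  refine ⟨m, (‖c - m‖⁻¹ : ℝ) • (c - m), ‖c - m‖, norm_nonneg _, ?_, ?_, hp0, ?_, h1, h2⟩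
  · rw [smul_smul, mul_inv_cancel₀ hcm', one_smul, add_sub_cancel]
  · rw [norm_smul, norm_inv, norm_norm, inv_mul_cancel₀ hcm']
  · rw [hqm, inner_neg_left, hp0, neg_zero]

/-! ### Mesh invariants and the insertion step -/

/-- The vertex set at the beginning of an iteration for the class `i`: periodic, with no large holes,
with distances at least `s`, and without poorly shaped triangles of smaller classes. -/
structure GoodMesh (s : ℝ) (i : ℕ) (S : Set Plane) : Prop where
  periodic : ∀ x ∈ S, ∀ v, x + latticeVec v ∈ S
  cover : ∀ x, ∃ y ∈ S, dist y x < 1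
  sep : ∀ x ∈ S, ∀ y ∈ S, x ≠ y → s ≤ dist x y
  shape : ∀ T, IsDelaunayTriangle S T → shortestSide T < (√2 : ℝ) ^ i * s →
    T.circumradius ≤ √2 * shortestSide T

/-- `S'` arises from `S` by an iteration for the class `i`. -/
def Inserts (s : ℝ) (i : ℕ) (S S' : Set Plane) : Prop :=
  ∃ I, IsMaximalIndependent (candidates s i S) I ∧ IsPeriodic I ∧ S' = S ∪ Sphere.center '' I

section

variable {s : ℝ} {i : ℕ} {S S' : Set Plane}

lemma GoodMesh.finite (h : GoodMesh s i S) (hs : 0 < s) (x : Plane) (r : ℝ) :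
    (S ∩ closedBall x r).Finite :=
  finite_inter_closedBall hs h.sep x r

lemma IsDelaunayTriangle.circumradius_lt_one {T : Affine.Triangle ℝ Plane}
    (hT : IsDelaunayTriangle S T) (hcov : ∀ x, ∃ y ∈ S, dist y x < 1) : T.circumradius < 1 := by
  obtain ⟨y, hy, h⟩ := hcov T.circumcenter
  exact (hT.2 y hy).trans_lt h

lemma IsDelaunayTriangle.translate {T : Affine.Triangle ℝ Plane} (hT : IsDelaunayTriangle S T)
    (hper : ∀ x ∈ S, ∀ v, x + latticeVec v ∈ S) (v : Fin 2 → ℤ) :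
    IsDelaunayTriangle S (translate T (latticeVec v)) := by
  refine ⟨fun k => ?_, fun x hx => ?_⟩
  · rw [translate_points]
    exact hper _ (hT.1 k) v
  · rw [translate_circumcenter, translate_circumradius]
    have := hT.2 _ (hper x hx (-v))
    rwa [latticeVec_neg, ← dist_add_right _ _ (latticeVec v), neg_add_cancel_right] at this

lemma isPeriodic_candidates (hper : ∀ x ∈ S, ∀ v, x + latticeVec v ∈ S) :
    IsPeriodic (candidates s i S) := by
  rintro _ ⟨T, hT, hpoor, hcl, rfl⟩ v
  refine ⟨translate T (latticeVec v), hT.translate hper v, ?_, ?_, ?_⟩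
  · rwa [PoorlyShaped, translate_circumradius, translate_shortestSide]
  · rwa [InClass, translate_shortestSide]
  · ext1
    · simp [translate_circumcenter]
    · simp [translate_circumradius]

lemma radius_lt_one_of_mem_candidates (hcov : ∀ x, ∃ y ∈ S, dist y x < 1) {b : Sphere Plane}
    (hb : b ∈ candidates s i S) : b.radius < 1 := by
  obtain ⟨T, hT, -, -, rfl⟩ := hb
  exact hT.circumradius_lt_one hcov

lemma radius_le_dist_of_mem_candidates {b : Sphere Plane} (hb : b ∈ candidates s i S) {x : Plane}
    (hx : x ∈ S) : b.radius ≤ dist x b.center := by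
  obtain ⟨T, hT, -, -, rfl⟩ := hb
  exact hT.2 x hx

/-- The shape threshold equals the ratio of consecutive classes, so the radius exceeds the upper end
of the class. -/
lemma lt_radius_of_mem_candidates {b : Sphere Plane} (hb : b ∈ candidates s i S) :
    (√2 : ℝ) ^ (i + 1) * s < b.radius := by
  obtain ⟨T, hT, hpoor, hcl, rfl⟩ := hb
  rw [poorlyShaped_iff] at hpoor
  refine lt_of_le_of_lt ?_ hpoor
  rw [pow_succ', mul_assoc]
  exact mul_le_mul_of_nonneg_left hcl.1 (by positivity)

lemma Conflicting.symm {a b : Sphere Plane} (h : Conflicting a b) : Conflicting b a := ⟨h.2, h.1⟩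

/-- Two conflicting circles, of which the first is translated. -/
lemma conflicting_translate_iff {a b : Sphere Plane} (v : Fin 2 → ℤ) :
    Conflicting ⟨a.center + latticeVec v, a.radius⟩ b ↔
      Conflicting a ⟨b.center + latticeVec (-v), b.radius⟩ := by
  have h : ∀ x y : Plane, dist x (y + latticeVec v) = dist (x + latticeVec (-v)) y := by
    intro x y
    rw [latticeVec_neg, ← dist_add_right (x + -latticeVec v) y (latticeVec v),
      neg_add_cancel_right]
  simp only [Conflicting, mem_ball]
  rw [h, dist_comm _ b.center, h, dist_comm a.center]

/-- In a mesh with these properties there is a periodic maximal independent set of candidates. -/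
lemma exists_inserts (h : GoodMesh s i S) :
    ∃ I, IsMaximalIndependent (candidates s i S) I ∧ IsPeriodic I := by
  -- Zorn's lemma is applied to periodic independent sets only; maximality among all independent
  -- sets follows because an addable circle could be added with its whole orbit `O`.
  obtain ⟨I, hI⟩ := zorn_subset {I | I ⊆ candidates s i S ∧ IsIndependent I ∧ IsPeriodic I} (by
    intro c hc hchain
    refine ⟨⋃₀ c, ⟨Set.sUnion_subset fun J hJ => (hc hJ).1, ?_, ?_⟩,
      fun J hJ => Set.subset_sUnion_of_mem hJ⟩
    · exact (Set.pairwise_sUnion hchain.directedOn).2 fun J hJ => (hc hJ).2.1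
    · rintro b ⟨J, hJ, hb⟩ v
      exact ⟨J, hJ, (hc hJ).2.2 b hb v⟩)
  obtain ⟨⟨hsub, hind, hper⟩, hmax⟩ := hI
  refine ⟨I, ⟨⟨hsub, hind⟩, ?_⟩, hper⟩
  rintro J ⟨hJsub, hJind⟩ hIJ b hbJ
  by_contra hbI
  set O : Set (Sphere Plane) := {a | ∃ v, a = ⟨b.center + latticeVec v, b.radius⟩} with hO
  have hbO : b ∈ O := ⟨0, by ext1 <;> simp [latticeVec_zero]⟩
  have hOI : ∀ a ∈ O, ∀ d ∈ I, ¬ Conflicting a d := by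
    rintro _ ⟨v, rfl⟩ d hd hcon
    rw [conflicting_translate_iff] at hcon
    have hd' := hper d hd (-v)
    exact hJind hbJ (hIJ hd') (fun e => hbI (by rw [e]; exact hd')) hcon
  -- Different translates have centers at distance at least 1, while candidate radii are below 1.
  have hOO : O.Pairwise fun a d => ¬ Conflicting a d := by
    rintro _ ⟨v, rfl⟩ _ ⟨w, rfl⟩ hne ⟨hcon, -⟩
    have hvw : w - v ≠ 0 := by
      intro e
      rw [sub_eq_zero] at e
      exact hne (by rw [e])
    have h1 := one_le_norm_latticeVec hvw
    have h2 := radius_lt_one_of_mem_candidates h.cover (hJsub hbJ)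
    rw [mem_ball, dist_add_left, dist_eq_norm, sub_eq_add_neg, ← latticeVec_neg, ← latticeVec_add,
      ← sub_eq_add_neg] at hcon
    linarith
  refine hbI (hmax (y := I ∪ O) ⟨?_, ?_, ?_⟩ Set.subset_union_left (Or.inr hbO))
  · refine Set.union_subset hsub ?_
    rintro _ ⟨v, rfl⟩
    exact isPeriodic_candidates h.periodic b (hJsub hbJ) v
  · exact Set.pairwise_union.2 ⟨hind, hOO, fun a ha d hd _ =>
      ⟨fun h' => hOI d hd a ha h'.symm, hOI d hd a ha⟩⟩
  · rintro a (ha | ⟨w, rfl⟩) v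
    · exact Or.inl (hper a ha v)
    · exact Or.inr ⟨w + v, by rw [latticeVec_add, add_assoc]⟩

/-- A pair of vertices at a small distance was there before the iteration. -/
lemma Inserts.mem_of_dist_le (hins : Inserts s i S S') {x y : Plane} (hx : x ∈ S') (hy : y ∈ S')
    (hxy : x ≠ y) (hd : dist x y ≤ (√2 : ℝ) ^ (i + 1) * s) : x ∈ S ∧ y ∈ S := by
  obtain ⟨I, hmax, -, rfl⟩ := hins
  have hsub := hmax.prop.1
  have aux : ∀ x ∈ S, ∀ b ∈ I, (√2 : ℝ) ^ (i + 1) * s < dist x b.center := fun x hx b hb =>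
    (lt_radius_of_mem_candidates (hsub hb)).trans_le
      (radius_le_dist_of_mem_candidates (hsub hb) hx)
  rcases hx with hx | ⟨a, ha, rfl⟩
  · rcases hy with hy | ⟨b, hb, rfl⟩
    · exact ⟨hx, hy⟩
    · exact absurd hd (aux x hx b hb).not_ge
  · rcases hy with hy | ⟨b, hb, rfl⟩
    · rw [dist_comm] at hd
      exact absurd hd (aux y hy a ha).not_ge
    · have hab : a ≠ b := fun e => hxy (by rw [e])
      -- Two new centers closer than both radii would conflict.
      have hcon := hmax.prop.2 ha hb hab
      have h1 := lt_radius_of_mem_candidates (hsub ha)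
      have h2 := lt_radius_of_mem_candidates (hsub hb)
      refine absurd ⟨?_, ?_⟩ hcon
      · rw [mem_ball, dist_comm]; exact hd.trans_lt h1
      · rw [mem_ball]; exact hd.trans_lt h2

lemma Inserts.subset (hins : Inserts s i S S') : S ⊆ S' := by
  obtain ⟨I, -, -, rfl⟩ := hins
  exact Set.subset_union_left

lemma le_sqrt_two_pow_mul (hs : 0 < s) (i : ℕ) : s ≤ (√2 : ℝ) ^ i * s :=
  le_mul_of_one_le_left hs.le (one_le_pow₀ (Real.one_le_sqrt.2 one_le_two))

lemma sqrt_two_pow_mul_lt (hs : 0 < s) (i : ℕ) : (√2 : ℝ) ^ i * s < (√2 : ℝ) ^ (i + 1) * s :=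
  mul_lt_mul_of_pos_right
    (pow_lt_pow_right₀ (by rw [Real.lt_sqrt] <;> norm_num) (Nat.lt_succ_self i)) hs

/-- No insertion revives a smaller class: a new poor triangle there would have an old shortest edge,
and its circle, empty also for `S`, would enlarge to that of a triangle of `S` that is at least as
poor and no longer in its shortest side. -/
lemma GoodMesh.inserts (hs : 0 < s) (h : GoodMesh s i S) (hins : Inserts s i S S') :
    GoodMesh s i S' where
  periodic := by
    obtain ⟨I, -, hper, rfl⟩ := hins
    rintro x (hx | ⟨b, hb, rfl⟩) v
    · exact Or.inl (h.periodic x hx v)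
    · exact Or.inr ⟨_, hper b hb v, rfl⟩
  cover x := by
    obtain ⟨y, hy, hd⟩ := h.cover x
    exact ⟨y, hins.subset hy, hd⟩
  sep x hx y hy hxy := by
    by_contra hlt
    obtain ⟨hx', hy'⟩ := hins.mem_of_dist_le hx hy hxy
      ((not_le.1 hlt).le.trans (le_sqrt_two_pow_mul hs _))
    exact hlt (h.sep x hx' y hy' hxy)
  shape T hT hlt := by
    by_contra! hpoor
    obtain ⟨k, l, hkl, hd⟩ := exists_shortestSide_eq T
    have hpq : T.points k ≠ T.points l := fun e => hkl (T.independent.injective e)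
    obtain ⟨hp, hq⟩ := hins.mem_of_dist_le (hT.1 k) (hT.1 l) hpq
      (by rw [hd]; exact (hlt.trans (sqrt_two_pow_mul_lt hs i)).le)
    have hr := T.dist_circumcenter_eq_circumradius
    have hpos := shortestSide_pos T
    have h2 : (1 : ℝ) ≤ √2 := Real.one_le_sqrt.2 one_le_two
    obtain ⟨m, n, t, ht, hc, hn, hpm, hqm, e1, e2⟩ := exists_bisector_direction
      (p := T.points k) (q := T.points l) (c := T.circumcenter) (by rw [hr, hr])
      (by rw [hr, hd]; nlinarith)
    obtain ⟨t', htt', -, -, T', hT', hside, -, hrad⟩ := exists_maximal_empty_circle (h.finite hs)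
      h.cover hp hq hpq hn hpm hqm (e1.trans e2.symm) (t₀ := t) (by
        intro x hx
        rw [← hc, hr]
        exact hT.2 x (hins.subset hx))
    have hle : T.circumradius ≤ T'.circumradius := by
      rw [hrad, ← hr k, hc, ← sq_le_sq₀ dist_nonneg dist_nonneg, dist_add_smul_sq hn hpm,
        dist_add_smul_sq hn hpm]
      nlinarith
    rw [hd] at hside
    have := h.shape T' hT' (hside.trans_lt hlt)
    have := mul_le_mul_of_nonneg_left hside (zero_le_one.trans h2)
    linarith

lemma GoodMesh.next (h : GoodMesh s i S) (hempty : candidates s i S = ∅) :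
    GoodMesh s (i + 1) S where
  periodic := h.periodic
  cover := h.cover
  sep := h.sep
  shape T hT hlt := by
    by_contra! hpoor
    by_cases hcl : shortestSide T < (√2 : ℝ) ^ i * s
    · exact hpoor.not_ge (h.shape T hT hcl)
    · have : T.circumsphere ∈ candidates s i S :=
        ⟨T, hT, (poorlyShaped_iff T _).2 hpoor, ⟨not_lt.1 hcl, hlt⟩, rfl⟩
      rw [hempty] at this
      exact this

lemma goodMesh_zero (hper : ∀ x ∈ S, ∀ v, x + latticeVec v ∈ S)
    (hcov : ∀ x, ∃ y ∈ S, dist y x < 1) (hsep : ∀ x ∈ S, ∀ y ∈ S, x ≠ y → s ≤ dist x y) :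
    GoodMesh s 0 S where
  periodic := hper
  cover := hcov
  sep := hsep
  shape T hT hlt := by
    obtain ⟨k, l, hkl, hd⟩ := exists_shortestSide_eq T
    have := hsep _ (hT.1 k) _ (hT.1 l) (fun e => hkl (T.independent.injective e))
    rw [hd] at this
    rw [pow_zero, one_mul] at hlt
    exact absurd this hlt.not_ge

end

/-! ### How a new vertex shrinks an empty circle, and a packing bound -/

/-- Every candidate circle contains a new vertex, which is closer to its center than to all old
vertices. -/
lemma Inserts.exists_mem_ball {s : ℝ} {i : ℕ} {S S' : Set Plane} (hs : 0 < s)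
    (hins : Inserts s i S S') {b : Sphere Plane} (hb : b ∈ candidates s i S) :
    ∃ x ∈ S', dist x b.center < b.radius ∧ ∀ y ∈ S, dist x b.center ≤ dist x y := by
  obtain ⟨I, hmax, -, rfl⟩ := hins
  obtain ⟨hsub, hind⟩ := hmax.prop
  by_cases hbI : b ∈ I
  · refine ⟨b.center, Or.inr ⟨b, hbI, rfl⟩, ?_, fun y _ => ?_⟩
    · rw [dist_self]
      exact (by positivity : (0 : ℝ) ≤ √2 ^ (i + 1) * s).trans_lt (lt_radius_of_mem_candidates hb)
    · rw [dist_self]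
      exact dist_nonneg
  · have : ∃ a ∈ I, Conflicting b a := by
      by_contra! hcon
      refine hbI (hmax.le_of_ge (y := insert b I) ⟨Set.insert_subset hb hsub, ?_⟩
        (Set.subset_insert _ _) (Set.mem_insert _ _))
      exact Set.pairwise_insert.2 ⟨hind, fun a ha _ =>
        ⟨hcon a ha, fun h => hcon a ha h.symm⟩⟩
    obtain ⟨a, ha, h1, h2⟩ := this
    refine ⟨a.center, Or.inr ⟨a, ha, rfl⟩, h1, fun y hy => ?_⟩
    rw [dist_comm _ y, dist_comm _ b.center]
    exact (mem_ball.1 h2).le.trans (radius_le_dist_of_mem_candidates (hsub ha) hy)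

/-- The radius of the largest empty circle drops if a vertex is inserted near the center. -/
lemma radius_le_of_near_center {p m n x : Plane} {t t' : ℝ} (hn : ‖n‖ = 1) (ht' : 0 ≤ t')
    (htt' : t' ≤ t) (hpm : ⟪p - m, n⟫ = 0) (hfar : √2 * (2 * ‖p - m‖) ≤ dist p (m + t' • n))
    (hx : dist x (m + t • n) ≤ 4 / 5 * dist p (m + t • n))
    (hempty : dist p (m + t' • n) ≤ dist x (m + t' • n)) :
    dist p (m + t' • n) ≤ 47 / 50 * dist p (m + t • n) := by
  have hR := dist_add_smul_sq hn hpm t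
  have hR' := dist_add_smul_sq hn hpm t'
  have h1 : dist (m + t • n) (m + t' • n) = t - t' := by
    rw [dist_add_left, dist_eq_norm, ← sub_smul, norm_smul, hn, mul_one, Real.norm_eq_abs,
      abs_of_nonneg (sub_nonneg.2 htt')]
  have h2 := dist_triangle x (m + t • n) (m + t' • n)
  have hRn := dist_nonneg (x := p) (y := m + t • n)
  have hRn' := dist_nonneg (x := p) (y := m + t' • n)
  set R := dist p (m + t • n)
  set R' := dist p (m + t' • n)
  have h3 : t ≤ R := le_of_sq_le_sq (by nlinarith [sq_nonneg ‖p - m‖]) hRn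
  -- `hfar` gives `8 * ‖p - m‖ ^ 2 ≤ R' ^ 2`, so `t' ≥ √(7/8) * R'`, and `√(7/8) > 93/100`.
  have h4 : 93 / 100 * R' ≤ t' := by
    have : 8 * ‖p - m‖ ^ 2 ≤ R' ^ 2 := by
      have := pow_le_pow_left₀ (by positivity) hfar 2
      rw [mul_pow, Real.sq_sqrt zero_le_two] at this
      linarith
    refine le_of_sq_le_sq ?_ ht'
    nlinarith [sq_nonneg R']
  -- Altogether `R' ≤ 4/5 R + t - t' ≤ 9/5 R - 93/100 R'`, and `1.8 / 1.93 < 47/50`.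
  linarith

/-- There are at most 25 points in a disk of radius `2 * ρ` of the plane whose mutual distances are
at least `ρ`. -/
lemma not_separated_of_dist_le {x : ℕ → Plane} {c : Plane} {ρ : ℝ} (hρ : 0 < ρ)
    (hnear : ∀ a < 26, dist (x a) c ≤ 2 * ρ)
    (hsep : ∀ a < 26, ∀ b < 26, a ≠ b → ρ ≤ dist (x a) (x b)) : False := by
  set f : ℕ → Plane := fun a => ρ⁻¹ • (x a - c) with hf
  have hfsep : ∀ a < 26, ∀ b < 26, a ≠ b → 1 ≤ ‖f a - f b‖ := by
    intro a ha b hb hab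
    rw [hf]
    simp only
    rw [← smul_sub, sub_sub_sub_cancel_right, norm_smul, ← dist_eq_norm, Real.norm_eq_abs,
      abs_of_pos (inv_pos.2 hρ), inv_mul_eq_div, one_le_div hρ]
    exact hsep a ha b hb hab
  have hinj : Set.InjOn f (Finset.range 26) := by
    intro a ha b hb hab
    by_contra hne
    have := hfsep a (by simpa using ha) b (by simpa using hb) hne
    rw [hab, sub_self, norm_zero] at this
    linarith
  -- After rescaling to separation 1 and radius 2, the bound is `5 ^ 2 = 25`.
  have hcard := Besicovitch.card_le_of_separated ((Finset.range 26).image f) (by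
      intro y hy
      obtain ⟨a, ha, rfl⟩ := Finset.mem_image.1 hy
      rw [hf]
      simp only
      rw [norm_smul, ← dist_eq_norm, Real.norm_eq_abs, abs_of_pos (inv_pos.2 hρ),
        inv_mul_eq_div, div_le_iff₀ hρ]
      exact hnear a (Finset.mem_range.1 ha)) (by
      intro y hy z hz hyz
      obtain ⟨a, ha, rfl⟩ := Finset.mem_image.1 hy
      obtain ⟨b, hb, rfl⟩ := Finset.mem_image.1 hz
      exact hfsep a (Finset.mem_range.1 ha) b (Finset.mem_range.1 hb) fun e => hyz (by rw [e]))
  rw [Finset.card_image_of_injOn hinj, Finset.card_range, finrank_euclideanSpace_fin] at hcard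
  norm_num at hcard

/-! ### Logarithmic bound for one inner loop -/

section

variable {s : ℝ} {i K : ℕ} {M : ℕ → Set Plane}

/-- A run of an inner loop, seen from an edge that still needs refinement at its end: there are
empty circles through the endpoints whose radii decrease by a constant factor within 26
iterations. -/
lemma exists_decreasing_radii (hs : 0 < s) (hgood : ∀ j ≤ K, GoodMesh s i (M j))
    (hins : ∀ j < K, Inserts s i (M j) (M (j + 1))) (hne : (candidates s i (M K)).Nonempty) :
    ∃ R : ℕ → ℝ, (∀ j ≤ K, s ≤ R j ∧ R j ≤ 1) ∧ ∀ j, j + 26 ≤ K → R (j + 26) ≤ 47 / 50 * R j := by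
  obtain ⟨_, T, hT, hpoor, hcl, rfl⟩ := hne
  rw [poorlyShaped_iff] at hpoor
  obtain ⟨k, l, hkl, hd⟩ := exists_shortestSide_eq T
  have hr := T.dist_circumcenter_eq_circumradius
  have hpq : T.points k ≠ T.points l := fun e => hkl (T.independent.injective e)
  have hp := hT.1 k
  have hq := hT.1 l
  have hpos := shortestSide_pos T
  have h2 : (1 : ℝ) ≤ √2 := Real.one_le_sqrt.2 one_le_two
  obtain ⟨m, n, t₀, ht₀, hc, hn, hpm, hqm, e1, e2⟩ := exists_bisector_direction
    (p := T.points k) (q := T.points l) (c := T.circumcenter) (by rw [hr, hr])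
    (by rw [hr, hd]; nlinarith)
  have hR₀ : dist (T.points k) (m + t₀ • n) = T.circumradius := by rw [← hc, hr]
  have hE₀ : ∀ x ∈ M K, dist (T.points k) (m + t₀ • n) ≤ dist x (m + t₀ • n) := by
    intro x hx
    rw [hR₀, ← hc]
    exact hT.2 x hx
  set p := T.points k
  set q := T.points l
  have hmono : ∀ j ≤ K, ∀ j' ≤ j, M j' ⊆ M j := by
    intro j
    induction j with
    | zero => intro _ j' hj'; rw [Nat.le_zero.1 hj']
    | succ j ih =>
      intro hj j' hj'
      rcases Nat.of_le_succ hj' with h | h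
      · exact (ih (by lia) j' h).trans (hins j (by lia)).subset
      · rw [h]
  -- Backward induction in time: the edge is too short to have a newly inserted endpoint.
  have hmem : ∀ d ≤ K, p ∈ M (K - d) ∧ q ∈ M (K - d) := by
    intro d
    induction d with
    | zero => exact fun _ => ⟨hp, hq⟩
    | succ d ih =>
      intro hdK
      obtain ⟨hp', hq'⟩ := ih (by lia)
      have := hins (K - (d + 1)) (by lia)
      rw [show K - (d + 1) + 1 = K - d by lia] at this
      exact this.mem_of_dist_le hp' hq' hpq (by rw [hd]; exact hcl.2.le)
  -- At each time the extremal circle through `p` and `q` is a candidate; the values for `j > K` are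
  -- irrelevant.
  have hstep : ∀ j, ∃ t, j ≤ K → t₀ ≤ t ∧
      (∀ t', (∀ x ∈ M j, dist p (m + t' • n) ≤ dist x (m + t' • n)) → t' ≤ t) ∧
      (∀ x ∈ M j, dist p (m + t • n) ≤ dist x (m + t • n)) ∧
      (⟨m + t • n, dist p (m + t • n)⟩ : Sphere Plane) ∈ candidates s i (M j) := by
    intro j
    by_cases hj : j ≤ K
    swap
    · exact ⟨0, fun h => absurd h hj⟩
    obtain ⟨hp', hq'⟩ := hmem (K - j) (by lia)
    rw [show K - (K - j) = j by lia] at hp' hq'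
    obtain ⟨t, htt, hmax, hE, T', hT', hside, hcc, hrad⟩ := exists_maximal_empty_circle
      ((hgood j hj).finite hs) (hgood j hj).cover hp' hq' hpq hn hpm hqm (e1.trans e2.symm)
      (fun x hx => hE₀ x (hmono K le_rfl j hj hx))
    refine ⟨t, fun _ => ⟨htt, hmax, hE, T', hT', ?_, ?_, ?_⟩⟩
    on_goal 3 => ext1 <;> simp [hcc, hrad]
    all_goals
      have hle : T.circumradius ≤ T'.circumradius := by
        rw [hrad, ← hR₀, ← sq_le_sq₀ dist_nonneg dist_nonneg, dist_add_smul_sq hn hpm,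
          dist_add_smul_sq hn hpm]
        nlinarith
      rw [hd] at hside
      have hmul := mul_le_mul_of_nonneg_left hside (zero_le_one.trans h2)
      have hpoor' : √2 * shortestSide T' < T'.circumradius := by linarith
    · rwa [poorlyShaped_iff]
    · refine ⟨?_, hside.trans_lt hcl.2⟩
      by_contra hlt
      exact hpoor'.not_ge ((hgood j hj).shape T' hT' (not_le.1 hlt))
  choose t ht using hstep
  set c : ℕ → Plane := fun j => m + t j • n with hcdef
  set R : ℕ → ℝ := fun j => dist p (c j) with hRdef
  -- A circle that is empty for a later, larger mesh is empty for the earlier one.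
  have htanti : ∀ j ≤ K, ∀ j' ≤ j, t j ≤ t j' := fun j hj j' hj' =>
    (ht j' (hj'.trans hj)).2.1 _ fun x hx => (ht j hj).2.2.1 x (hmono j hj j' hj' hx)
  have hRsq : ∀ j, R j ^ 2 = t j ^ 2 + ‖p - m‖ ^ 2 := fun j => dist_add_smul_sq hn hpm _
  have hRnn : ∀ j, 0 ≤ R j := fun j => dist_nonneg
  have htnn : ∀ j ≤ K, 0 ≤ t j := fun j hj => ht₀.trans (ht j hj).1
  have hRanti : ∀ j ≤ K, ∀ j' ≤ j, R j ≤ R j' := by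
    intro j hj j' hj'
    rw [← sq_le_sq₀ (hRnn _) (hRnn _), hRsq, hRsq]
    have := pow_le_pow_left₀ (htnn j hj) (htanti j hj j' hj') 2
    linarith
  have hRlow : ∀ j ≤ K, T.circumradius ≤ R j := by
    intro j hj
    rw [← hR₀, ← sq_le_sq₀ dist_nonneg (hRnn _), hRsq, dist_add_smul_sq hn hpm]
    have := pow_le_pow_left₀ ht₀ (ht j hj).1 2
    linarith
  have hfar : ∀ j ≤ K, √2 * (2 * ‖p - m‖) ≤ R j := by
    intro j hj
    rw [e1, mul_div_cancel₀ _ two_ne_zero, hd]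
    exact hpoor.le.trans (hRlow j hj)
  have hpierce : ∀ j, ∃ x, j < K → x ∈ M (j + 1) ∧ dist x (c j) < R j ∧
      ∀ y ∈ M j, dist x (c j) ≤ dist x y := by
    intro j
    by_cases hj : j < K
    · obtain ⟨x, hx⟩ := (hins j hj).exists_mem_ball hs (ht j hj.le).2.2.2
      exact ⟨x, fun _ => hx⟩
    · exact ⟨0, fun h => absurd h hj⟩
  choose x hx using hpierce
  refine ⟨R, fun j hj => ⟨?_, ?_⟩, fun j hj => ?_⟩
  · have := (hgood K le_rfl).sep p hp q hq hpq
    rw [hd] at this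
    have := hRlow j hj
    nlinarith
  · exact (radius_lt_one_of_mem_candidates (hgood j hj).cover (ht j hj).2.2.2).le
  by_contra! hbig
  have hRj : 0 < R j := lt_of_lt_of_le (by nlinarith) (hRlow j (by lia))
  have hlow : ∀ a ≤ 26, 47 / 50 * R j ≤ R (j + a) := fun a ha =>
    hbig.le.trans (hRanti (j + 26) hj (j + a) (by lia))
  -- If the radius drops too little over 26 iterations, no new vertex comes near its center.
  have haway : ∀ a < 26, 4 / 5 * R (j + a) ≤ dist (x (j + a)) (c (j + a)) := by
    intro a ha
    by_contra! hnear
    have hle := radius_le_of_near_center hn (htnn (j + a + 1) (by lia))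
      (htanti (j + a + 1) (by lia) (j + a) (by lia)) hpm (hfar (j + a + 1) (by lia)) hnear.le
      ((ht (j + a + 1) (by lia)).2.2.1 _ (hx (j + a) (by lia)).1)
    have h3 : R (j + 26) ≤ 47 / 50 * R (j + a) :=
      (hRanti (j + 26) hj (j + a + 1) (by lia)).trans hle
    have h4 := hRanti (j + a) (by lia) j (by lia)
    linarith
  -- Here `188/250 = 4/5 * 47/50`: the later vertex is at least as far from the earlier one as from
  -- its own center.
  have hsep : ∀ a < 26, ∀ b < 26, a ≠ b → 188 / 250 * R j ≤ dist (x (j + a)) (x (j + b)) := by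
    have aux : ∀ a b, a < b → b < 26 → 188 / 250 * R j ≤ dist (x (j + b)) (x (j + a)) := by
      intro a b hab hb
      have h3 := (hx (j + b) (by lia)).2.2 _
        (hmono (j + b) (by lia) (j + a + 1) (by lia) (hx (j + a) (by lia)).1)
      have h4 := haway b hb
      have h5 := hlow b hb.le
      linarith
    intro a ha b hb hab
    rcases lt_or_gt_of_ne hab with h | h
    · rw [dist_comm]; exact aux a b h hb
    · exact aux b a h ha
  -- The centers move by at most `R j - 4/5 * R j`, so all these vertices are within `6/5 * R j` of
  -- `c j`.
  have hnear : ∀ a < 26, dist (x (j + a)) (c j) ≤ 2 * (188 / 250 * R j) := by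
    intro a ha
    have h3 := dist_triangle (x (j + a)) (c (j + a)) (c j)
    have h4 : dist (c (j + a)) (c j) = t j - t (j + a) := by
      rw [dist_comm, hcdef]
      simp only
      rw [dist_add_left, dist_eq_norm, ← sub_smul, norm_smul, hn, mul_one, Real.norm_eq_abs,
        abs_of_nonneg (sub_nonneg.2 (htanti (j + a) (by lia) j (by lia)))]
    have h5 := (hx (j + a) (by lia)).2.1
    have h6 := hRanti (j + a) (by lia) j (by lia)
    have h7 : t j ≤ R j :=
      le_of_sq_le_sq (by rw [hRsq j]; exact le_add_of_nonneg_right (sq_nonneg _)) (hRnn j)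
    have h8 : 4 / 5 * R j ≤ t (j + a) := by
      refine le_of_sq_le_sq ?_ (htnn (j + a) (by lia))
      have h9 := pow_le_pow_left₀ (by positivity) (hfar (j + a) (by lia)) 2
      rw [mul_pow, Real.sq_sqrt zero_le_two] at h9
      have h10 := pow_le_pow_left₀ (by positivity) (hlow a ha.le) 2
      rw [mul_pow] at h9 h10 ⊢
      linarith [hRsq (j + a), sq_nonneg (R j)]
    linarith
  exact not_separated_of_dist_le (x := fun a => x (j + a)) (c := c j) (ρ := 188 / 250 * R j) (by positivity) hnear hsep

/-- The bound for the number of iterations of an inner loop. -/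
lemma iterations_le (hs : 0 < s) (hgood : ∀ j ≤ K, GoodMesh s i (M j))
    (hins : ∀ j < K, Inserts s i (M j) (M (j + 1))) (hne : (candidates s i (M K)).Nonempty) :
    (K : ℝ) ≤ 26 * (Real.log s⁻¹ / Real.log (50 / 47) + 1) := by
  obtain ⟨R, hR, hdec⟩ := exists_decreasing_radii hs hgood hins hne
  have hpow : ∀ a, 26 * a ≤ K → R (26 * a) ≤ (47 / 50) ^ a := by
    intro a
    induction a with
    | zero => intro _; simpa using (hR 0 (Nat.zero_le _)).2
    | succ a ih =>
      intro ha
      have h1 := ih (by lia)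
      have h2 := hdec (26 * a) (by lia)
      rw [mul_add, mul_one, pow_succ]
      linarith
  have h1 : s ≤ (47 / 50 : ℝ) ^ (K / 26) :=
    (hR _ (Nat.mul_div_le _ _)).1.trans (hpow _ (Nat.mul_div_le _ _))
  have h2 : ((K / 26 : ℕ) : ℝ) * Real.log (50 / 47) ≤ Real.log s⁻¹ := by
    rw [← Real.log_pow]
    refine Real.log_le_log (by positivity) ?_
    rw [show (50 / 47 : ℝ) = (47 / 50)⁻¹ by norm_num, inv_pow]
    exact inv_anti₀ hs h1
  have h3 : (0 : ℝ) < Real.log (50 / 47) := Real.log_pos (by norm_num)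
  rw [← le_div_iff₀ h3] at h2
  have h4 : (K : ℝ) ≤ 26 * ((K / 26 : ℕ) : ℝ) + 26 := by
    exact_mod_cast (by lia : K ≤ 26 * (K / 26) + 26)
  linarith

end

/-! ### The initial periodic point set -/

section

variable {P : Set Plane}

lemma add_latticeVec_mem_periodicSet :
    ∀ x ∈ periodicSet P, ∀ v, x + latticeVec v ∈ periodicSet P := by
  rintro _ ⟨p, hp, w, rfl⟩ v
  exact ⟨p, hp, w + v, by rw [latticeVec_add, add_assoc]⟩

lemma periodicSet_cover (hP : P.Nonempty) : ∀ x, ∃ y ∈ periodicSet P, dist y x < 1 := by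
  obtain ⟨p, hp⟩ := hP
  intro x
  obtain ⟨v, hv⟩ := exists_dist_latticeVec_lt (x - p)
  refine ⟨p + latticeVec v, ⟨p, hp, v, rfl⟩, ?_⟩
  rwa [← dist_add_left p, add_sub_cancel] at hv

lemma finite_periodicSet_inter_closedBall (hP : P.Finite) (x : Plane) (r : ℝ) :
    (periodicSet P ∩ closedBall x r).Finite := by
  refine (hP.biUnion (t := fun p => (fun v => p + latticeVec v) ''
    {v | latticeVec v ∈ closedBall (x - p) r})
    fun p _ => (finite_latticeVec_closedBall _ _).image _).subset ?_
  rintro _ ⟨⟨p, hp, v, rfl⟩, hd⟩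
  refine Set.mem_iUnion₂.2 ⟨p, hp, v, ?_, rfl⟩
  rw [Set.mem_ofPred_eq, mem_closedBall, ← dist_add_left p, add_sub_cancel]
  exact hd

/-- Two points at minimal distance. -/
lemma exists_closest_pair (hfin : P.Finite) (hP : P.Nonempty) :
    ∃ a ∈ periodicSet P, ∃ b ∈ periodicSet P, a ≠ b ∧
      ∀ x ∈ periodicSet P, ∀ y ∈ periodicSet P, x ≠ y → dist a b ≤ dist x y := by
  -- Up to translation the first point is in `P`, and distances above 1 are irrelevant since a point
  -- and its unit translate are at distance 1. This leaves finitely many pairs.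
  set F : Set (Plane × Plane) :=
    {z | z.1 ∈ P ∧ z.2 ∈ periodicSet P ∧ z.1 ≠ z.2 ∧ dist z.2 z.1 ≤ 1} with hF
  have hFfin : F.Finite := by
    refine (hfin.biUnion (t := fun p => (fun y => (p, y)) '' (periodicSet P ∩ closedBall p 1))
      fun p _ => (finite_periodicSet_inter_closedBall hfin p 1).image _).subset ?_
    rintro ⟨p, y⟩ ⟨hp, hy, -, hd⟩
    exact Set.mem_iUnion₂.2 ⟨p, hp, y, ⟨hy, hd⟩, rfl⟩
  have hmem : ∀ p ∈ P, p ∈ periodicSet P := fun p hp => ⟨p, hp, 0, by simp [latticeVec_zero]⟩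
  obtain ⟨p, hp⟩ := hP
  have hFne : F.Nonempty := by
    have hnorm : ‖latticeVec (Pi.single 0 1)‖ = 1 := by
      simp [EuclideanSpace.norm_eq, latticeVec, Pi.single_apply]
    refine ⟨(p, p + latticeVec (Pi.single 0 1)), hp, ⟨p, hp, _, rfl⟩, ?_, ?_⟩
    · intro h
      have h' : latticeVec (Pi.single 0 1) = 0 := by simpa using h
      rw [h', norm_zero] at hnorm
      exact zero_ne_one hnorm
    · simp [dist_eq_norm, hnorm]
  obtain ⟨⟨a, b⟩, ⟨ha, hb, hab, hd⟩, hmin⟩ :=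
    Set.exists_min_image F (fun z => dist z.1 z.2) hFfin hFne
  refine ⟨a, hmem a ha, b, hb, hab, ?_⟩
  rintro _ ⟨q, hq, v, rfl⟩ y hy hxy
  have hy' := add_latticeVec_mem_periodicSet y hy (-v)
  have hdist : dist q (y + latticeVec (-v)) = dist (q + latticeVec v) y := by
    rw [latticeVec_neg, ← dist_add_right q _ (latticeVec v), neg_add_cancel_right]
  rw [← hdist]
  by_cases h : dist (y + latticeVec (-v)) q ≤ 1
  · refine hmin (q, y + latticeVec (-v)) ⟨hq, hy', ?_, h⟩
    exact dist_ne_zero.1 (by rw [hdist]; exact dist_ne_zero.2 hxy)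
  · rw [dist_comm a b, dist_comm q]
    exact hd.trans (not_le.1 h).le

/-- The points of a closest pair span a Delaunay edge. -/
lemma isDelaunayEdge_of_closest {S : Set Plane} {a b : Plane} (ha : a ∈ S) (hb : b ∈ S)
    (hab : a ≠ b) (hmin : ∀ x ∈ S, ∀ y ∈ S, x ≠ y → dist a b ≤ dist x y) :
    IsDelaunayEdge S a b := by
  have h1 : dist a (midpoint ℝ a b) = dist a b / 2 := by
    rw [dist_left_midpoint]; norm_num; ring
  have h2 : dist b (midpoint ℝ a b) = dist a b / 2 := by
    rw [dist_right_midpoint]; norm_num; ring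
  refine ⟨ha, hb, hab, midpoint ℝ a b, h1.trans h2.symm, fun x hx => ?_⟩
  by_cases hxa : x = a
  · rw [hxa]
  by_cases hxb : x = b
  · rw [hxb, h1, h2]
  have e1 := hmin x hx a ha hxa
  have e2 := hmin x hx b hb hxb
  have hpos := dist_pos.2 hab
  -- With `d = dist a b` and `x` at distance at least `d` from both endpoints, this gives squared
  -- distance at least `3/4 * d ^ 2` from the midpoint, more than the squared radius `d ^ 2 / 4`.
  have hpar := parallelogram_law_with_norm ℝ (x - midpoint ℝ a b) (a - midpoint ℝ a b)
  rw [sub_sub_sub_cancel_right, ← dist_eq_norm x a, ← dist_eq_norm x (midpoint ℝ a b),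
    ← dist_eq_norm a (midpoint ℝ a b), h1] at hpar
  have hsum : ‖x - midpoint ℝ a b + (a - midpoint ℝ a b)‖ = dist x b := by
    have : a - midpoint ℝ a b = -(b - midpoint ℝ a b) := by
      rw [left_sub_midpoint, right_sub_midpoint, ← smul_neg, neg_sub]
    rw [this, ← sub_eq_add_neg, sub_sub_sub_cancel_right, dist_eq_norm]
  rw [hsum] at hpar
  rw [h1]
  have h0 := dist_nonneg (x := x) (y := midpoint ℝ a b)
  refine le_of_sq_le_sq ?_ h0
  nlinarith [mul_self_le_mul_self hpos.le e1, mul_self_le_mul_self hpos.le e2]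

/-- The shortest Delaunay edge is positive and the minimal distance of the set. -/
lemma shortestDelaunayEdge_spec (hfin : P.Finite) (hP : P.Nonempty) :
    0 < shortestDelaunayEdge (periodicSet P) ∧ ∀ x ∈ periodicSet P, ∀ y ∈ periodicSet P,
      x ≠ y → shortestDelaunayEdge (periodicSet P) ≤ dist x y := by
  obtain ⟨a, ha, b, hb, hab, hmin⟩ := exists_closest_pair hfin hP
  have hleast : IsLeast {d : ℝ | ∃ p q : Plane, IsDelaunayEdge (periodicSet P) p q ∧ d = dist p q}
      (dist a b) := by
    refine ⟨⟨a, b, isDelaunayEdge_of_closest ha hb hab hmin, rfl⟩, ?_⟩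
    rintro _ ⟨p, q, hpq, rfl⟩
    exact hmin p hpq.1 q hpq.2.1 hpq.2.2.1
  have : shortestDelaunayEdge (periodicSet P) = dist a b := hleast.csInf_eq
  rw [this]
  exact ⟨dist_pos.2 hab, hmin⟩

end

/-! ### Invariant of a whole run -/

/-- What is known about a configuration of a run with `N` passes, if `B` bounds the number of
iterations of an inner loop after which candidates are left: the vertex sets during the current
inner loop, and the bounds for the counters. -/
structure RunInvariant (s B : ℝ) (N : ℕ) (X : Config) : Prop where
  history : ∃ M : ℕ → Set Plane, M X.inner = X.mesh ∧ (∀ j ≤ X.inner, GoodMesh s X.phase (M j)) ∧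
    ∀ j < X.inner, Inserts s X.phase (M j) (M (j + 1))
  phase_le : X.phase ≤ N
  inner_le : (X.inner : ℝ) ≤ B + 1
  total_le : (X.total : ℝ) ≤ X.phase * (B + 1) + X.inner

lemma RunInvariant.goodMesh {s B : ℝ} {N : ℕ} {X : Config} (h : RunInvariant s B N X) :
    GoodMesh s X.phase X.mesh := by
  obtain ⟨M, hM, hgood, -⟩ := h.history
  rw [← hM]
  exact hgood _ le_rfl

/-- The loop bound applies before an insertion, while candidates remain, hence the `+ 1` in `B + 1`.
Closing a pass charges its iterations to one more term `B + 1` in the total. -/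
lemma RunInvariant.step {s B : ℝ} {N : ℕ} (hs : 0 < s) (hB : 0 ≤ B)
    (hsB : 26 * (Real.log s⁻¹ / Real.log (50 / 47) + 1) ≤ B) {X Y : Config}
    (h : RunInvariant s B N X) (hXY : Step s N X Y) : RunInvariant s B N Y := by
  cases hXY with
  | @insert i k n S I hi hne hmax hper =>
    obtain ⟨M, hM, hgood, hins⟩ := h.history
    have htotal := h.total_le
    simp only at hM hgood hins htotal
    have hk := iterations_le hs hgood hins (by rwa [hM])
    have hnew : Inserts s i S (S ∪ Sphere.center '' I) := ⟨I, hmax, hper, rfl⟩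
    set M' : ℕ → Set Plane := fun j => if j ≤ k then M j else S ∪ Sphere.center '' I with hM'
    have h1 : ∀ j ≤ k, M' j = M j := fun j hj => if_pos hj
    have h2 : M' (k + 1) = S ∪ Sphere.center '' I := if_neg (by lia)
    refine ⟨⟨M', h2, ?_, ?_⟩, hi.le, ?_, ?_⟩
    · intro j hj
      rcases Nat.of_le_succ hj with hj | rfl
      · rw [h1 j hj]; exact hgood j hj
      · have := h.goodMesh.inserts hs hnew
        rwa [← h2] at this
    · intro j hj
      rcases (Nat.lt_succ_iff.1 hj).lt_or_eq with hj | rfl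
      · rw [h1 j hj.le, h1 (j + 1) hj]; exact hins j hj
      · rw [h1 j le_rfl, hM]; exact h2 ▸ hnew
    · push_cast; linarith
    · push_cast; linarith
  | @next i k n S hi hempty =>
    have htotal := h.total_le
    have hinner := h.inner_le
    simp only at htotal hinner
    refine ⟨⟨fun _ => S, rfl, fun _ _ => h.goodMesh.next hempty, fun j hj => ?_⟩, hi, ?_, ?_⟩
    · exact absurd hj (Nat.not_lt_zero j)
    · push_cast; linarith
    · push_cast; linarith

lemma RunInvariant.exists_step {s B : ℝ} {N : ℕ} {X : Config} (h : RunInvariant s B N X)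
    (hX : X.phase < N) : ∃ Y, Step s N X Y := by
  have hgood := h.goodMesh
  obtain ⟨i, k, n, S⟩ := X
  rcases (candidates s i S).eq_empty_or_nonempty with he | hne
  · exact ⟨_, Step.next hX he⟩
  · obtain ⟨I, hmax, hper⟩ := exists_inserts hgood
    exact ⟨_, Step.insert I hX hne hmax hper⟩

lemma runInvariant_init {P : Set Plane} (hfin : P.Finite) (hP : P.Nonempty) {B : ℝ} (hB : 0 ≤ B)
    (N : ℕ) : RunInvariant (shortestDelaunayEdge (periodicSet P)) B N
      (Config.init (periodicSet P)) where
  history := ⟨fun _ => periodicSet P, rfl, fun _ _ => goodMesh_zero add_latticeVec_mem_periodicSet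
    (periodicSet_cover hP) (shortestDelaunayEdge_spec hfin hP).2,
    fun j hj => absurd hj (Nat.not_lt_zero j)⟩
  phase_le := Nat.zero_le _
  inner_le := by simp only [Config.init]; push_cast; linarith
  total_le := by simp [Config.init]

lemma Reachable.runInvariant {P : Set Plane} (hfin : P.Finite) (hP : P.Nonempty) {L B : ℝ}
    (hB : 0 ≤ B) (hsB : 26 * (Real.log (shortestDelaunayEdge (periodicSet P))⁻¹ /
      Real.log (50 / 47) + 1) ≤ B) {X : Config} (hX : Reachable P L X) :
    RunInvariant (shortestDelaunayEdge (periodicSet P)) B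
      (outerPasses L (shortestDelaunayEdge (periodicSet P))) X := by
  induction hX with
  | refl => exact runInvariant_init hfin hP hB _
  | tail _ hstep ih => exact ih.step (shortestDelaunayEdge_spec hfin hP).1 hB hsB hstep

/-! ### Comparison with `log (L / s)` and conclusion -/

lemma outerPasses_le (L s : ℝ) :
    (outerPasses L s : ℝ) ≤ ((Real.log √2)⁻¹ + 1) * max 1 (Real.log (L / s)) := by
  have h2 : 0 < Real.log √2 := Real.log_pos (by rw [Real.lt_sqrt] <;> norm_num)
  have h1 : (1 : ℝ) ≤ max 1 (Real.log (L / s)) := le_max_left _ _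
  have hlog : Real.logb √2 (L / s) ≤ (Real.log √2)⁻¹ * max 1 (Real.log (L / s)) := by
    rw [Real.logb, div_eq_inv_mul]
    exact mul_le_mul_of_nonneg_left (le_max_right _ _) (by positivity)
  have hceil : (⌈Real.logb √2 (L / s)⌉₊ : ℝ) ≤
      (Real.log √2)⁻¹ * max 1 (Real.log (L / s)) + 1 :=
    (Nat.cast_le.2 (Nat.ceil_mono hlog)).trans (Nat.ceil_lt_add_one (by positivity)).le
  unfold outerPasses
  linarith

/-- Since `log s⁻¹ = log (L / s) - log L`, the lower bound `c` on `L` costs at most `|log c|`,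
absorbed by the maximum with 1. -/
lemma log_inv_le {c L s : ℝ} (hc : 0 < c) (hcL : c ≤ L) (hs : 0 < s) :
    Real.log s⁻¹ ≤ (1 + |Real.log c|) * max 1 (Real.log (L / s)) := by
  have h1 : (1 : ℝ) ≤ max 1 (Real.log (L / s)) := le_max_left _ _
  have h2 : Real.log (L / s) ≤ max 1 (Real.log (L / s)) := le_max_right _ _
  have h3 := Real.log_le_log hc hcL
  have h4 := neg_abs_le (Real.log c)
  have h5 : Real.log s⁻¹ = Real.log (L / s) - Real.log L := by
    rw [Real.log_div (hc.trans_le hcL).ne' hs.ne', Real.log_inv]; ring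
  have h6 := le_mul_of_one_le_right (abs_nonneg (Real.log c)) h1
  linarith

end Refinement

theorem mainTheorem2 (c : ℝ) (hc : 0 < c) :
    ∃ C : ℝ, ∀ (P : Finset Plane) (L s : ℝ) (N : ℕ),
      P.Nonempty → (∀ p ∈ P, ∀ k, p k ∈ Set.Ico (0 : ℝ) 1) →
      Metric.diam (P : Set Plane) ≤ L → c ≤ L →
      s = Refinement.shortestDelaunayEdge (Refinement.periodicSet P) →
      N = Refinement.outerPasses L s →
      0 < s ∧
      (N : ℝ) ≤ C * max 1 (Real.log (L / s)) ∧
      ∀ X : Refinement.Config, Refinement.Reachable P L X →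
        (X.inner : ℝ) ≤ C * max 1 (Real.log (L / s)) ∧
        (X.total : ℝ) ≤ C * (max 1 (Real.log (L / s))) ^ 2 ∧
        X.phase ≤ N ∧
        (X.phase < N → ∃ Y : Refinement.Config, Refinement.Step s N X Y) := by
  have hκ : 0 < Real.log (50 / 47) := Real.log_pos (by norm_num)
  have h2 : 0 < Real.log √2 := Real.log_pos (by rw [Real.lt_sqrt] <;> norm_num)
  set A₁ : ℝ := (Real.log √2)⁻¹ + 1 with hA₁
  set A₂ : ℝ := 26 * ((1 + |Real.log c|) / Real.log (50 / 47) + 1) with hA₂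
  have hA₁pos : 0 < A₁ := by positivity
  have hA₂pos : 0 < A₂ := by positivity
  refine ⟨(A₁ + 1) * (A₂ + 1), ?_⟩
  intro P L s N hP _ _ hcL hs hN
  have hspos : 0 < s := by
    rw [hs]; exact (Refinement.shortestDelaunayEdge_spec P.finite_toSet hP).1
  have hNle : (N : ℝ) ≤ A₁ * max 1 (Real.log (L / s)) := by
    rw [hN]; exact Refinement.outerPasses_le L s
  have hloginv := Refinement.log_inv_le hc hcL hspos
  have hℓ : (1 : ℝ) ≤ max 1 (Real.log (L / s)) := le_max_left _ _
  set ℓ := max 1 (Real.log (L / s))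
  have hsB : 26 * (Real.log s⁻¹ / Real.log (50 / 47) + 1) ≤ A₂ * ℓ := by
    rw [hA₂, mul_assoc, add_mul, one_mul, div_mul_eq_mul_div]
    gcongr
  have hcoef : ∀ A ≤ (A₁ + 1) * (A₂ + 1), A * ℓ ≤ (A₁ + 1) * (A₂ + 1) * ℓ := fun A hA =>
    mul_le_mul_of_nonneg_right hA (zero_le_one.trans hℓ)
  refine ⟨hspos, hNle.trans (hcoef _ (by nlinarith)), fun X hX => ?_⟩
  -- The invariant is used with `B = A₂ * ℓ`.
  have hinv := hX.runInvariant P.finite_toSet hP (by positivity) (hs ▸ hsB)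
  rw [← hs, ← hN] at hinv
  have hinner : (X.inner : ℝ) ≤ (A₂ + 1) * ℓ := hinv.inner_le.trans (by linarith)
  refine ⟨hinner.trans (hcoef _ (by nlinarith)), ?_, hinv.phase_le, hinv.exists_step⟩
  have hphase : (X.phase : ℝ) ≤ A₁ * ℓ := (Nat.cast_le.2 hinv.phase_le).trans hNle
  calc (X.total : ℝ) ≤ X.phase * (A₂ * ℓ + 1) + X.inner := hinv.total_le
    _ ≤ A₁ * ℓ * ((A₂ + 1) * ℓ) + ℓ * ((A₂ + 1) * ℓ) := by
      refine add_le_add (mul_le_mul hphase (by linarith) (by positivity) (by positivity)) ?_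
      exact hinner.trans (le_mul_of_one_le_left (by positivity) hℓ)
    _ = (A₁ + 1) * (A₂ + 1) * ℓ ^ 2 := by ring
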